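/- Let $(\mathcal G,d_{\mathcal G})$ be a compact metric space, let $W>0$, and let $\mathcal X=M_{\le W}(\mathcal G)$ be the set of positive Borel measures on $\mathcal G$ of total mass at most $W$. Equip $\mathcal X$ with the bounded-Lipschitz metric $d_{\mathrm{BL}}(\mu,\mu')=\sup\int f\,d(\mu-\mu')$, where the supremum is over all $f:\mathcal G\to\mathbb R$ with $\|f\|_\infty\le1$ and Lipschitz constant at most $1$ (this makes $\mathcal X$ a compact metric space), and with its Borel $\sigma$-algebra. Let $\mathcal A$ be a nonempty compact metric space of actions with its Borel $\sigma$-algebra. Let $P(\cdot\mid x,a)$ be a transition probability kernel from $\mathcal X\times\mathcal A$ to $\mathcal X$ that is weakly continuous: for every bounded continuous $f:\mathcal X\to\mathbb R$ the map $(x,a)\mapsto\int f(x')\,P(dx'\mid x,a)$ is continuous. Let the goal set be $G=\{0\}$ (the zero measure), which is closed in $\mathcal X$. A policy $\pi$ chooses the action $A_n$ at each time $n$ by a probability kernel given the history $(X_0,A_0,\dots,A_{n-1},X_n)$, and then $X_{n+1}\sim P(\cdot\mid X_n,A_n)$. For $b\in\mathbb N$ and $x\in\mathcal X$ put $$V_b^\pi(x)=\mathbb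 P^\pi\bigl(\exists t\in\{0,\dots,b\}:X_t\in G\mid X_0=x\bigr),\qquad V_b^*(x)=\sup_\pi V_b^\pi(x),$$ and, for $b\ge1$, $Q_b^*(x,a)=\int_{\mathcal X}V_{b-1}^*(x')\,P(dx'\mid x,a)$. Then for every $B\in\mathbb N$: (a) $V_0^*=\mathbf 1_G$, and $V_{b+1}^*(x)=\max\bigl(\mathbf 1_G(x),\ \sup_{a\in\mathcal A}Q_{b+1}^*(x,a)\bigr)$ for all $0\le b<B$ and $x\in\mathcal X$; and $V_b^*$ is Borel measurable for every $0\le b\le B$. (b) For every $1\le b\le B$ and $x\in\mathcal X$, the supremum $\sup_{a\in\mathcal A}Q_b^*(x,a)$ is attained. (c) There are Borel measurable maps $a_b^*:\mathcal X\to\mathcal A$, $1\le b\le B$, such that $a_b^*(x)$ maximizes $Q_b^*(x,\cdot)$ for every $x\in\mathcal X$ and $1\le b\le B$, and such that the deterministic Markov policy $\pi^*$ that plays $a_b^*(X_{B-b})$ when $b$ steps remain (at time $B-b$) satisfies $V_B^{\pi^*}(x)=V_B^*(x)$ for every $x\in\mathcal X$. -/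

import Mathlib

open MeasureTheory ProbabilityTheory
open scoped BoundedContinuousFunction

noncomputable section

namespace Provability

/-! ### The space of goal measures with the bounded Lipschitz metric -/

/-- `M_{≤W}(𝒢)`: the positive Borel measures on `𝒢` of total mass at most `W`. -/
@[ext]
structure GoalMeasure (𝒢 : Type*) [MeasurableSpace 𝒢] (W : ℝ) where
  /-- the underlying Borel measure -/
  toMeasure : Measure 𝒢
  mass_le : toMeasure Set.univ ≤ ENNReal.ofReal W

/-- The unit ball of the bounded Lipschitz norm: `max (‖f‖_∞, Lip f) ≤ 1`. -/
def BLUnitBall (𝒢 : Type*) [MetricSpace 𝒢] : Set (𝒢 → ℝ) :=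
  {f | (∀ x, |f x| ≤ 1) ∧ LipschitzWith 1 f}

lemma zero_mem_BLUnitBall {𝒢 : Type*} [MetricSpace 𝒢] : (fun _ => 0 : 𝒢 → ℝ) ∈ BLUnitBall 𝒢 :=
  ⟨fun _ => by simp, LipschitzWith.const' 0⟩

lemma neg_mem_BLUnitBall {𝒢 : Type*} [MetricSpace 𝒢] {f : 𝒢 → ℝ} (hf : f ∈ BLUnitBall 𝒢) :
    (fun x => -f x) ∈ BLUnitBall 𝒢 :=
  ⟨fun x => by simpa using hf.1 x, hf.2.neg⟩

instance {𝒢 : Type*} [MetricSpace 𝒢] : Nonempty (BLUnitBall 𝒢) := ⟨⟨_, zero_mem_BLUnitBall⟩⟩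

namespace GoalMeasure

section Basic

variable {𝒢 : Type*} [MeasurableSpace 𝒢] {W : ℝ}

instance (μ : GoalMeasure 𝒢 W) : IsFiniteMeasure μ.toMeasure :=
  ⟨μ.mass_le.trans_lt ENNReal.ofReal_lt_top⟩

/-- The zero measure, which represents the solved state (no goals left). -/
instance : Zero (GoalMeasure 𝒢 W) := ⟨⟨0, by simp⟩⟩

end Basic

variable {𝒢 : Type*} [MetricSpace 𝒢] [MeasurableSpace 𝒢] {W : ℝ}

/-- The bounded Lipschitz distance
`d_BL(μ, ν) = sup_{‖f‖_BL ≤ 1} ∫ f d(μ - ν)`. -/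
def dBL (μ ν : GoalMeasure 𝒢 W) : ℝ :=
  ⨆ f : BLUnitBall 𝒢, ((∫ x, f.1 x ∂μ.toMeasure) - ∫ x, f.1 x ∂ν.toMeasure)

lemma abs_integral_le (μ : GoalMeasure 𝒢 W) (f : BLUnitBall 𝒢) :
    |∫ x, f.1 x ∂μ.toMeasure| ≤ μ.toMeasure.real Set.univ := by
  have h := norm_integral_le_of_norm_le_const (μ := μ.toMeasure) (f := f.1) (C := 1)
    (Filter.Eventually.of_forall fun x => f.2.1 x)
  simpa using h

lemma bddAbove_dBL (μ ν : GoalMeasure 𝒢 W) :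
    BddAbove (Set.range fun f : BLUnitBall 𝒢 =>
      (∫ x, f.1 x ∂μ.toMeasure) - ∫ x, f.1 x ∂ν.toMeasure) := by
  refine ⟨μ.toMeasure.real Set.univ + ν.toMeasure.real Set.univ, ?_⟩
  rintro _ ⟨f, rfl⟩
  have h1 := abs_le.1 (abs_integral_le μ f)
  have h2 := abs_le.1 (abs_integral_le ν f)
  simp only
  linarith [h1.2, h2.1]

lemma sub_le_dBL (μ ν : GoalMeasure 𝒢 W) (f : BLUnitBall 𝒢) :
    (∫ x, f.1 x ∂μ.toMeasure) - ∫ x, f.1 x ∂ν.toMeasure ≤ dBL μ ν :=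
  le_ciSup (bddAbove_dBL μ ν) f

lemma dBL_self (μ : GoalMeasure 𝒢 W) : dBL μ μ = 0 := by simp [dBL]

lemma dBL_le_swap (μ ν : GoalMeasure 𝒢 W) : dBL μ ν ≤ dBL ν μ := by
  refine ciSup_le fun f => ?_
  have h := sub_le_dBL ν μ ⟨_, neg_mem_BLUnitBall f.2⟩
  simp only [integral_neg] at h
  linarith

lemma dBL_comm (μ ν : GoalMeasure 𝒢 W) : dBL μ ν = dBL ν μ :=
  le_antisymm (dBL_le_swap μ ν) (dBL_le_swap ν μ)

lemma dBL_triangle (μ ν ρ : GoalMeasure 𝒢 W) : dBL μ ρ ≤ dBL μ ν + dBL ν ρ := by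
  refine ciSup_le fun f => ?_
  linarith [sub_le_dBL μ ν f, sub_le_dBL ν ρ f]

lemma integral_eq_of_dBL_eq_zero {μ ν : GoalMeasure 𝒢 W} (h : dBL μ ν = 0)
    (f : BLUnitBall 𝒢) : ∫ x, f.1 x ∂μ.toMeasure = ∫ x, f.1 x ∂ν.toMeasure := by
  have h1 := sub_le_dBL μ ν f
  have h2 := sub_le_dBL ν μ f
  rw [dBL_comm] at h2
  linarith

lemma eq_of_dBL_eq_zero [BorelSpace 𝒢] {μ ν : GoalMeasure 𝒢 W} (h : dBL μ ν = 0) : μ = ν := by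
  -- scaled thickened indicators of a closed set lie in the unit ball
  have key : ∀ (F : Set 𝒢) (δ : ℝ) (hδ : 0 < δ), δ ≤ 1 →
      ∫⁻ x, thickenedIndicator hδ F x ∂μ.toMeasure =
        ∫⁻ x, thickenedIndicator hδ F x ∂ν.toMeasure := by
    intro F δ hδ hδ1
    have hle : ∀ x, (thickenedIndicator hδ F x : ℝ) ≤ 1 := fun x => by
      exact_mod_cast thickenedIndicator_le_one hδ F x
    have hmem : (fun x => δ * (thickenedIndicator hδ F x : ℝ)) ∈ BLUnitBall 𝒢 := by
      refine ⟨fun x => ?_, LipschitzWith.of_dist_le_mul fun x y => ?_⟩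
      · rw [abs_of_nonneg (by positivity)]
        exact mul_le_one₀ hδ1 (by positivity) (hle x)
      · have hL := (lipschitzWith_thickenedIndicator hδ F).dist_le_mul x y
        rw [NNReal.dist_eq] at hL
        rw [Real.dist_eq, ← mul_sub, abs_mul, abs_of_pos hδ]
        have h2 := mul_le_mul_of_nonneg_left hL hδ.le
        rw [NNReal.coe_inv, Real.coe_toNNReal _ hδ.le, mul_inv_cancel_left₀ hδ.ne'] at h2
        simpa using h2
    have hI := integral_eq_of_dBL_eq_zero h ⟨_, hmem⟩
    simp only [integral_const_mul] at hI
    have hI' := mul_left_cancel₀ hδ.ne' hI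
    rw [← BoundedContinuousFunction.toReal_lintegral_coe_eq_integral,
      ← BoundedContinuousFunction.toReal_lintegral_coe_eq_integral] at hI'
    exact (ENNReal.toReal_eq_toReal_iff'
      (BoundedContinuousFunction.lintegral_lt_top_of_nnreal _ _).ne
      (BoundedContinuousFunction.lintegral_lt_top_of_nnreal _ _).ne).1 hI'
  have hclosed : ∀ F : Set 𝒢, IsClosed F → μ.toMeasure F = ν.toMeasure F := by
    intro F hF
    have hpos : ∀ n : ℕ, (0 : ℝ) < 1 / ((n : ℝ) + 1) := fun n => by positivity
    have hlim := tendsto_one_div_add_atTop_nhds_zero_nat (𝕜 := ℝ)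
    refine tendsto_nhds_unique
      (tendsto_lintegral_thickenedIndicator_of_isClosed μ.toMeasure hF hpos hlim) ?_
    refine (tendsto_lintegral_thickenedIndicator_of_isClosed ν.toMeasure hF hpos hlim).congr
      fun n => (key F _ (hpos n) ?_).symm
    rw [div_le_one (by positivity)]
    linarith [Nat.cast_nonneg (α := ℝ) n]
  exact GoalMeasure.ext (ext_of_generate_finite _
    (BorelSpace.measurable_eq.trans borel_eq_generateFrom_isClosed) isPiSystem_isClosed
    (fun F hF => hclosed F hF) (hclosed _ isClosed_univ))

/-- `M_{≤W}(𝒢)` is metrized by the bounded Lipschitz distance. -/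
instance [BorelSpace 𝒢] : MetricSpace (GoalMeasure 𝒢 W) where
  dist := dBL
  dist_self := dBL_self
  dist_comm := dBL_comm
  dist_triangle := dBL_triangle
  eq_of_dist_eq_zero := eq_of_dBL_eq_zero

/-- The Borel σ-algebra of `d_BL`. -/
instance [BorelSpace 𝒢] : MeasurableSpace (GoalMeasure 𝒢 W) := borel _

instance [BorelSpace 𝒢] : BorelSpace (GoalMeasure 𝒢 W) := ⟨rfl⟩

end GoalMeasure

/-! ### Finite-horizon reachability in a Markov decision process -/

section MDP

variable {X A : Type*} [MeasurableSpace X] [MeasurableSpace A]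

/-- Histories up to time `n`: the states `X_0, …, X_n` and the actions `A_0, …, A_{n-1}`. -/
abbrev History (X A : Type*) (n : ℕ) : Type _ := (Fin (n + 1) → X) × (Fin n → A)

/-- A (randomized, history-dependent) policy: at every time `n`, a stochastic kernel that draws
the action `A_n` given the history up to time `n`. -/
structure Policy (X A : Type*) [MeasurableSpace X] [MeasurableSpace A] where
  /-- the conditional law of `A_n` given the history up to time `n` -/
  act : ∀ n : ℕ, Kernel (History X A n) A
  isMarkovKernel_act : ∀ n, IsMarkovKernel (act n)

/-- The law of `X_{n+1}` given the history up to time `n` and the action `A_n`: it is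
`P(· ∣ X_n, A_n)`. -/
def nextState (P : Kernel (X × A) X) (n : ℕ) : Kernel (History X A n × A) X :=
  P.comap (fun p => (p.1.1 (Fin.last n), p.2)) (by fun_prop)

/-- Append the action `A_n` and the state `X_{n+1}` to a history up to time `n`. -/
def History.extend {X A : Type*} (n : ℕ) (p : (History X A n × A) × X) : History X A (n + 1) :=
  (Fin.snoc (α := fun _ => X) p.1.1.1 p.2, Fin.snoc (α := fun _ => A) p.1.1.2 p.1.2)

/-- The law under `ℙ^π(· ∣ X_0 = x)` of the history up to time `n`: draw `A_n` from the policy,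
then `X_{n+1}` from the transition kernel. -/
def historyLaw (P : Kernel (X × A) X) (π : Policy X A) (x : X) :
    (n : ℕ) → Measure (History X A n)
  | 0 => Measure.dirac (fun _ => x, Fin.elim0)
  | n + 1 => (((historyLaw P π x n) ⊗ₘ (π.act n)) ⊗ₘ (nextState P n)).map (History.extend n)

/-- `V_b^π(x) = ℙ^π(∃ t ∈ {0, …, b}, X_t ∈ G ∣ X_0 = x)`. -/
def successProb (P : Kernel (X × A) X) (G : Set X) (π : Policy X A) (b : ℕ) (x : X) : ℝ :=
  (historyLaw P π x b).real {h | ∃ t : Fin (b + 1), h.1 t ∈ G}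

/-- `V_b^*(x) = sup_π V_b^π(x)`. -/
def optValue (P : Kernel (X × A) X) (G : Set X) (b : ℕ) (x : X) : ℝ :=
  ⨆ π : Policy X A, successProb P G π b x

/-- `Q_b^*(x, a) = ∫ V_{b-1}^*(x') P(dx' ∣ x, a)`, for `b ≥ 1`. -/
def optActionValue (P : Kernel (X × A) X) (G : Set X) (b : ℕ) (x : X) (a : A) : ℝ :=
  ∫ x', optValue P G (b - 1) x' ∂(P (x, a))

/-- The deterministic Markov policy that plays `A_t = d_t(X_t)` at every time `t`. -/
def Policy.deterministicMarkov (d : ℕ → X → A) (hd : ∀ t, Measurable (d t)) : Policy X A where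
  act n := Kernel.deterministic (fun h : History X A n => d n (h.1 (Fin.last n)))
    ((hd n).comp (by fun_prop))
  isMarkovKernel_act _ := inferInstance

/-- Weak continuity (Feller condition): `(x, a) ↦ ∫ f dP(· ∣ x, a)` is continuous for every bounded
continuous `f`. -/
def IsWeaklyContinuous [TopologicalSpace X] [TopologicalSpace A] (P : Kernel (X × A) X) : Prop :=
  ∀ f : X →ᵇ ℝ, Continuous fun p : X × A => ∫ x', f x' ∂(P p)

end MDP

end Provability

end

noncomputable section

namespace Provability

/-! ### Upper semicontinuous functions on a product with a compact factor -/

section Semicontinuity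

variable {X A : Type*} [TopologicalSpace X] [TopologicalSpace A]

/-! Everything is proved for the functions `bellmanValue` defined by the Bellman recursion, which
are then identified with `optValue`.

Regularity: the indicator of a closed set is upper semicontinuous. A Feller kernel preserves upper
semicontinuity of `[0,1]`-valued functions (`upperSemicontinuous_integral_kernel`), and so does a
supremum over a compact action space. Hence every iterate is upper semicontinuous and therefore
Borel, the suprema over actions are attained, and maximizers can be selected measurably
(`exists_measurable_argmax`).

Verification: let the process `continuationValue` be 1 once the goal has been visited and the
Bellman value of the current state before that. It is a supermartingale under every policy and a
martingale under the greedy one. It starts at the Bellman value and ends as the indicator of a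
visit, so success probabilities are at most the Bellman value, with equality for the greedy policy.
-/

lemma isClosed_setOf_exists_le [CompactSpace A] {f : X × A → ℝ} (hf : UpperSemicontinuous f)
    {F : Set A} (hF : IsClosed F) (q : ℝ) : IsClosed {x | ∃ a ∈ F, q ≤ f (x, a)} := by
  have h1 : IsClosed ((f ⁻¹' Set.Ici q) ∩ (Prod.snd ⁻¹' F)) :=
    (upperSemicontinuous_iff_isClosed_preimage.1 hf q).inter (hF.preimage continuous_snd)
  -- Projection along a compact factor is a closed map.
  have h2 := isClosedMap_fst_of_compactSpace _ h1
  convert h2 using 1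
  ext x
  simp [and_comm]

lemma upperSemicontinuous_section {f : X × A → ℝ} (hf : UpperSemicontinuous f) (x : X) :
    UpperSemicontinuous fun a => f (x, a) :=
  hf.comp (f := f) (g := fun a => (x, a)) (by fun_prop)

lemma exists_forall_le_of_upperSemicontinuous [CompactSpace A] [Nonempty A] {f : X × A → ℝ}
    (hf : UpperSemicontinuous f) (x : X) : ∃ a, ∀ a', f (x, a') ≤ f (x, a) := by
  obtain ⟨a, -, ha⟩ := UpperSemicontinuousOn.exists_isMaxOn Set.univ_nonempty isCompact_univ
    ((upperSemicontinuous_section hf x).upperSemicontinuousOn _)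
  exact ⟨a, fun a' => ha (Set.mem_univ a')⟩

/-- The supremum is attained, so its superlevel sets are exactly the projections of those of `f`. -/
lemma upperSemicontinuous_iSup_of_compactSpace [CompactSpace A] [Nonempty A] {f : X × A → ℝ}
    (hf : UpperSemicontinuous f) : UpperSemicontinuous fun x => ⨆ a, f (x, a) := by
  rw [upperSemicontinuous_iff_isClosed_preimage]
  intro q
  convert isClosed_setOf_exists_le hf isClosed_univ q using 1
  ext x
  obtain ⟨a, ha⟩ := exists_forall_le_of_upperSemicontinuous hf x
  have hbdd : BddAbove (Set.range fun a => f (x, a)) := ⟨f (x, a), by rintro _ ⟨a', rfl⟩; exact ha a'⟩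
  simp only [Set.mem_preimage, Set.mem_Ici, Set.mem_univ, true_and, Set.mem_ofPred_eq]
  exact ⟨fun h => ⟨a, h.trans (ciSup_le ha)⟩, fun ⟨a', h⟩ => h.trans (le_ciSup hbdd a')⟩

variable [MeasurableSpace X] [OpensMeasurableSpace X]

/-- A nonempty closed `F` contains no maximizer exactly when some rational separates the maximum
over `F` from the global one; this writes the complement as a countable union of Borel sets. -/
lemma measurableSet_exists_isMax_mem [CompactSpace A] {f : X × A → ℝ}
    (hf : UpperSemicontinuous f) {F : Set A} (hF : IsClosed F) :
    MeasurableSet {x | ∃ a ∈ F, ∀ a', f (x, a') ≤ f (x, a)} := by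
  have hcompl : {x | ∃ a ∈ F, ∀ a', f (x, a') ≤ f (x, a)}ᶜ =
      {_x | ¬ F.Nonempty} ∪ ⋃ q : ℚ, {x | ∃ a ∈ F, (q : ℝ) ≤ f (x, a)}ᶜ ∩
        {x | ∃ a ∈ (Set.univ : Set A), (q : ℝ) ≤ f (x, a)} := by
    ext x
    simp only [Set.mem_compl_iff, Set.mem_ofPred_eq, Set.mem_union, Set.mem_iUnion, Set.mem_inter_iff,
      Set.mem_univ, true_and]
    constructor
    · intro h
      by_cases hne : F.Nonempty
      · right
        obtain ⟨a, haF, ha⟩ := UpperSemicontinuousOn.exists_isMaxOn hne hF.isCompact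
          ((upperSemicontinuous_section hf x).upperSemicontinuousOn _)
        push Not at h
        obtain ⟨a', ha'⟩ := h a haF
        obtain ⟨q, hq1, hq2⟩ := exists_rat_btwn ha'
        exact ⟨q, fun ⟨c, hcF, hc⟩ => absurd (hc.trans (ha hcF)) (not_le.2 hq1), a', hq2.le⟩
      · exact Or.inl hne
    · rintro (h | ⟨q, h1, a', ha'⟩) ⟨a, haF, ha⟩
      · exact h ⟨a, haF⟩
      · exact h1 ⟨a, haF, ha'.trans (ha a')⟩
  rw [← MeasurableSet.compl_iff, hcompl]
  exact (MeasurableSet.const _).union (MeasurableSet.iUnion fun q =>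
    (isClosed_setOf_exists_le hf hF q).measurableSet.compl.inter
      (isClosed_setOf_exists_le hf isClosed_univ q).measurableSet)

end Semicontinuity

/-- Measurable maximum theorem: an upper semicontinuous function on a product with a compact metric
space `A` has a measurable selection of maximizers. The selection is the least maximizer with
respect to a parametrization of `A` by the Cantor set. -/
lemma exists_measurable_argmax {X A : Type*} [TopologicalSpace X] [MeasurableSpace X]
    [OpensMeasurableSpace X] [MetricSpace A] [CompactSpace A] [Nonempty A] [MeasurableSpace A]
    [BorelSpace A] {f : X × A → ℝ} (hf : UpperSemicontinuous f) :
    ∃ s : X → A, Measurable s ∧ ∀ x a, f (x, a) ≤ f (x, s x) := by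
  obtain ⟨g₀, hg₀, hg₀s⟩ := exists_nat_bool_continuous_surjective_of_compact A
  let g : cantorSet → A := g₀ ∘ cantorSetHomeomorphNatToBool
  have hg : Continuous g := hg₀.comp cantorSetHomeomorphNatToBool.continuous
  have hgs : Function.Surjective g := hg₀s.comp cantorSetHomeomorphNatToBool.surjective
  have : CompactSpace cantorSet := isCompact_iff_compactSpace.1 isCompact_cantorSet
  have hfg : UpperSemicontinuous fun p : X × cantorSet => f (p.1, g p.2) :=
    hf.comp (f := f) (g := fun p : X × cantorSet => (p.1, g p.2)) (by fun_prop)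
  have hleast : ∀ x, ∃ t, IsLeast {t : cantorSet | ∀ a, f (x, a) ≤ f (x, g t)} t := by
    intro x
    have hclosed : IsClosed {t : cantorSet | ∀ a, f (x, a) ≤ f (x, g t)} := by
      rw [Set.ofPred_forall]
      exact isClosed_iInter fun a => upperSemicontinuous_iff_isClosed_preimage.1
        (upperSemicontinuous_section hfg x) (f (x, a))
    refine hclosed.isCompact.exists_isLeast ?_
    obtain ⟨a, ha⟩ := exists_forall_le_of_upperSemicontinuous hf x
    obtain ⟨t, rfl⟩ := hgs a
    exact ⟨t, ha⟩
  choose t ht using hleast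
  have htm : Measurable fun x => (t x : ℝ) := by
    refine measurable_of_Iic fun r => ?_
    -- The least maximizer is at most `r` iff some maximizer lies in the closed set of parameters at
    -- most `r`.
    convert measurableSet_exists_isMax_mem hfg (F := {u : cantorSet | (u : ℝ) ≤ r})
      (isClosed_le continuous_subtype_val continuous_const) using 1
    ext x
    simp only [Set.mem_preimage, Set.mem_Iic, Set.mem_ofPred_eq]
    constructor
    · exact fun h => ⟨t x, h, fun u => (ht x).1 (g u)⟩
    · rintro ⟨u, hur, hu⟩
      refine le_trans ?_ hur
      refine (ht x).2 fun a => ?_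
      obtain ⟨v, rfl⟩ := hgs a
      exact hu v
  exact ⟨fun x => g (t x), hg.measurable.comp (htm.subtype_mk (h := fun x => (t x).2)),
    fun x => (ht x).1⟩

/-! ### Upper semicontinuity of integrals against a Feller kernel -/

section Envelope

variable {X : Type*} [MetricSpace X]

/-- The `n`-Lipschitz upper envelope `x ↦ sup_y (V y - n d(x, y))`. -/
def lipschitzEnvelope (V : X → ℝ) (n : ℕ) (x : X) : ℝ := ⨆ y, (V y - n * dist x y)

variable {V : X → ℝ}

lemma bddAbove_lipschitzEnvelope (hV : ∀ x, V x ∈ Set.Icc (0 : ℝ) 1) (n : ℕ) (x : X) :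
    BddAbove (Set.range fun y => V y - n * dist x y) := by
  refine ⟨1, ?_⟩
  rintro _ ⟨y, rfl⟩
  have h : 0 ≤ (n : ℝ) * dist x y := by positivity
  simp only
  linarith [(hV y).2]

lemma le_lipschitzEnvelope (hV : ∀ x, V x ∈ Set.Icc (0 : ℝ) 1) (n : ℕ) (x : X) :
    V x ≤ lipschitzEnvelope V n x := by
  simpa [lipschitzEnvelope] using le_ciSup (bddAbove_lipschitzEnvelope hV n x) x

lemma lipschitzEnvelope_le_one (hV : ∀ x, V x ∈ Set.Icc (0 : ℝ) 1) (n : ℕ) (x : X) :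
    lipschitzEnvelope V n x ≤ 1 := by
  have : Nonempty X := ⟨x⟩
  refine ciSup_le fun y => ?_
  have h : 0 ≤ (n : ℝ) * dist x y := by positivity
  linarith [(hV y).2]

lemma lipschitzWith_lipschitzEnvelope (hV : ∀ x, V x ∈ Set.Icc (0 : ℝ) 1) (n : ℕ) :
    LipschitzWith n (lipschitzEnvelope V n) := by
  refine LipschitzWith.of_le_add_mul _ fun x x' => ?_
  have : Nonempty X := ⟨x⟩
  refine ciSup_le fun y => ?_
  have h1 : V y - n * dist x' y ≤ lipschitzEnvelope V n x' :=
    le_ciSup (bddAbove_lipschitzEnvelope hV n x') y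
  have h2 : (n : ℝ) * dist x' y ≤ n * (dist x x' + dist x y) := by
    gcongr
    rw [dist_comm x x']
    exact dist_triangle _ _ _
  simp only [NNReal.coe_natCast]
  linarith

/-- Semicontinuity controls the `y` within `δ` of `x`; beyond `δ` the penalty exceeds `n * δ > 1`,
more than `V` can vary. -/
lemma tendsto_lipschitzEnvelope (hV : ∀ x, V x ∈ Set.Icc (0 : ℝ) 1) (husc : UpperSemicontinuous V)
    (x : X) : Filter.Tendsto (fun n => lipschitzEnvelope V n x) Filter.atTop (nhds (V x)) := by
  have : Nonempty X := ⟨x⟩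
  rw [Metric.tendsto_atTop]
  intro ε hε
  obtain ⟨δ, hδ, hball⟩ := Metric.eventually_nhds_iff.1 (husc x (V x + ε / 2) (by linarith))
  obtain ⟨N, hN⟩ := exists_nat_gt (1 / δ)
  refine ⟨N, fun n hn => ?_⟩
  have hle : lipschitzEnvelope V n x ≤ V x + ε / 2 := by
    refine ciSup_le fun y => ?_
    by_cases hy : dist y x < δ
    · have h : 0 ≤ (n : ℝ) * dist x y := by positivity
      linarith [hball hy]
    · have h1 : 1 < (N : ℝ) * δ := by rwa [div_lt_iff₀ hδ] at hN
      have h2 : (N : ℝ) * δ ≤ n * dist x y := by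
        rw [dist_comm x y]
        have : (N : ℝ) ≤ n := by exact_mod_cast hn
        gcongr
        exact not_lt.1 hy
      linarith [(hV y).2, (hV x).1]
  rw [Real.dist_eq, abs_of_nonneg (sub_nonneg.2 (le_lipschitzEnvelope hV n x))]
  linarith

variable [MeasurableSpace X] [BorelSpace X]

/-- A Feller kernel maps upper semicontinuous functions to upper semicontinuous functions. -/
lemma upperSemicontinuous_integral_kernel {Z : Type*} [TopologicalSpace Z] [MeasurableSpace Z]
    (P : Kernel Z X) [IsMarkovKernel P]
    (hP : ∀ f : X →ᵇ ℝ, Continuous fun z => ∫ x', f x' ∂(P z))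
    (hV : ∀ x, V x ∈ Set.Icc (0 : ℝ) 1) (husc : UpperSemicontinuous V) :
    UpperSemicontinuous fun z => ∫ x', V x' ∂(P z) := by
  have hnorm : ∀ n x, ‖lipschitzEnvelope V n x‖ ≤ 1 := fun n x => by
    rw [Real.norm_of_nonneg ((hV x).1.trans (le_lipschitzEnvelope hV n x))]
    exact lipschitzEnvelope_le_one hV n x
  have hcont : ∀ n, Continuous (lipschitzEnvelope V n) :=
    fun n => (lipschitzWith_lipschitzEnvelope hV n).continuous
  have hint : ∀ n z, Integrable (lipschitzEnvelope V n) (P z) := fun n z =>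
    Integrable.of_bound (hcont n).aestronglyMeasurable 1 (.of_forall (hnorm n))
  have hVint : ∀ z, Integrable V (P z) := fun z =>
    Integrable.of_bound husc.measurable.aestronglyMeasurable 1
      (.of_forall fun x => by rw [Real.norm_of_nonneg (hV x).1]; exact (hV x).2)
  -- If `y` exceeds the integral of `V` at `z`, so does it exceed that of some envelope. The latter
  -- integral is continuous in the base point, hence stays below `y` nearby, and it dominates the
  -- integral of `V`.
  intro z y hy
  have hlim : Filter.Tendsto (fun n => ∫ x', lipschitzEnvelope V n x' ∂(P z)) Filter.atTop
      (nhds (∫ x', V x' ∂(P z))) :=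
    tendsto_integral_of_dominated_convergence (fun _ => 1)
      (fun n => (hcont n).aestronglyMeasurable) (integrable_const _)
      (fun n => .of_forall (hnorm n)) (.of_forall fun x => tendsto_lipschitzEnvelope hV husc x)
  obtain ⟨n, hn⟩ := (hlim.eventually (gt_mem_nhds hy)).exists
  have hc := hP (BoundedContinuousFunction.ofNormedAddCommGroup _ (hcont n) 1 (hnorm n))
  filter_upwards [hc.continuousAt.eventually (gt_mem_nhds hn)] with z' hz'
  exact (integral_mono (hVint z') (hint n z') (le_lipschitzEnvelope hV n)).trans_lt hz'

end Envelope

/-! ### Value iteration -/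

section ValueIteration

variable {X A : Type*} [MeasurableSpace X] [MeasurableSpace A]

/-- Value iteration: the finite horizon values computed by the Bellman recursion. -/
def bellmanValue (P : Kernel (X × A) X) (G : Set X) : ℕ → X → ℝ
  | 0 => Set.indicator G 1
  | b + 1 => fun x => max (Set.indicator G 1 x) (⨆ a, ∫ x', bellmanValue P G b x' ∂(P (x, a)))

lemma integral_mem_Icc {Y : Type*} [MeasurableSpace Y] (μ : Measure Y) [IsProbabilityMeasure μ]
    {V : Y → ℝ} (hV : ∀ x, V x ∈ Set.Icc (0 : ℝ) 1) : ∫ x, V x ∂μ ∈ Set.Icc (0 : ℝ) 1 := by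
  refine ⟨integral_nonneg fun x => (hV x).1, ?_⟩
  have h := norm_integral_le_of_norm_le_const (μ := μ) (f := V) (C := 1)
    (.of_forall fun x => by rw [Real.norm_of_nonneg (hV x).1]; exact (hV x).2)
  simpa using (le_abs_self _).trans h

lemma indicator_one_mem_Icc {Y : Type*} (G : Set Y) (x : Y) :
    Set.indicator G (1 : Y → ℝ) x ∈ Set.Icc (0 : ℝ) 1 := by
  by_cases hx : x ∈ G <;> simp [hx]

variable (P : Kernel (X × A) X) [IsMarkovKernel P] (G : Set X)

lemma bellmanValue_mem_Icc [Nonempty A] (b : ℕ) (x : X) :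
    bellmanValue P G b x ∈ Set.Icc (0 : ℝ) 1 := by
  induction b generalizing x with
  | zero => exact indicator_one_mem_Icc G x
  | succ b ih =>
    refine ⟨(indicator_one_mem_Icc G x).1.trans (le_max_left _ _),
      max_le (indicator_one_mem_Icc G x).2 (ciSup_le fun a => (integral_mem_Icc _ ih).2)⟩

lemma bellmanValue_of_mem [Nonempty A] (b : ℕ) {x : X} (hx : x ∈ G) : bellmanValue P G b x = 1 := by
  refine le_antisymm (bellmanValue_mem_Icc P G b x).2 ?_
  cases b with
  | zero => simp [bellmanValue, hx]
  | succ b => exact le_max_of_le_left (by simp [hx])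

lemma integral_bellmanValue_le [Nonempty A] (b : ℕ) (x : X) (a : A) :
    ∫ x', bellmanValue P G b x' ∂(P (x, a)) ≤ bellmanValue P G (b + 1) x := by
  refine le_max_of_le_right (le_ciSup (f := fun a => ∫ x', bellmanValue P G b x' ∂(P (x, a))) ?_ a)
  -- Boundedness matters: a real supremum of an unbounded family defaults to 0.
  refine ⟨1, ?_⟩
  rintro _ ⟨a, rfl⟩
  exact (integral_mem_Icc _ (bellmanValue_mem_Icc P G b)).2

/-- Off `G` the indicator is 0 and drops out of the maximum against nonnegative integrals. On `G`
this can fail, since `G` need not be absorbing. -/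
lemma bellmanValue_succ_of_isMax [Nonempty A] (b : ℕ) {x : X} (hx : x ∉ G) {a : A}
    (ha : ∀ a', ∫ x', bellmanValue P G b x' ∂(P (x, a')) ≤
      ∫ x', bellmanValue P G b x' ∂(P (x, a))) :
    bellmanValue P G (b + 1) x = ∫ x', bellmanValue P G b x' ∂(P (x, a)) := by
  refine le_antisymm (max_le ?_ (ciSup_le ha)) (integral_bellmanValue_le P G b x a)
  rw [Set.indicator_of_notMem hx]
  exact (integral_mem_Icc _ (bellmanValue_mem_Icc P G b)).1

end ValueIteration

section Feller

variable {X A : Type*} [MetricSpace X] [MeasurableSpace X] [BorelSpace X]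
  [TopologicalSpace A] [CompactSpace A] [Nonempty A] [MeasurableSpace A]
  {P : Kernel (X × A) X} [IsMarkovKernel P] {G : Set X}

lemma upperSemicontinuous_bellmanValue (hP : IsWeaklyContinuous P) (hG : IsClosed G) (b : ℕ) :
    UpperSemicontinuous (bellmanValue P G b) := by
  have hind : UpperSemicontinuous (Set.indicator G (1 : X → ℝ)) :=
    hG.upperSemicontinuous_indicator zero_le_one
  induction b with
  | zero => exact hind
  | succ b ih =>
    exact hind.sup (upperSemicontinuous_iSup_of_compactSpace
      (upperSemicontinuous_integral_kernel P hP (bellmanValue_mem_Icc P G b) ih))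

lemma upperSemicontinuous_integral_bellmanValue (hP : IsWeaklyContinuous P) (hG : IsClosed G)
    (b : ℕ) : UpperSemicontinuous fun p : X × A => ∫ x', bellmanValue P G b x' ∂(P p) :=
  upperSemicontinuous_integral_kernel P hP (bellmanValue_mem_Icc P G b)
    (upperSemicontinuous_bellmanValue hP hG b)

lemma measurable_bellmanValue (hP : IsWeaklyContinuous P) (hG : IsClosed G) (b : ℕ) :
    Measurable (bellmanValue P G b) :=
  (upperSemicontinuous_bellmanValue hP hG b).measurable

end Feller

/-! ### The law of the history and the success probability -/

section HistoryLaw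

variable {X A : Type*} [MeasurableSpace X] [MeasurableSpace A]

lemma History.measurable_extend (n : ℕ) :
    Measurable (History.extend n : (History X A n × A) × X → History X A (n + 1)) := by
  refine Measurable.prodMk (measurable_pi_iff.2 fun i => ?_) (measurable_pi_iff.2 fun i => ?_)
  · refine Fin.lastCases ?_ (fun i => ?_) i
    · simpa using measurable_snd
    · simp only [Fin.snoc_castSucc]
      fun_prop
  · refine Fin.lastCases ?_ (fun i => ?_) i
    · simp only [Fin.snoc_last]
      fun_prop
    · simp only [Fin.snoc_castSucc]
      fun_prop

/-- The histories up to time `n` that have visited `G`. -/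
def hitSet (X A : Type*) (G : Set X) (n : ℕ) : Set (History X A n) := {h | ∃ t, h.1 t ∈ G}

lemma measurableSet_hitSet {G : Set X} (hG : MeasurableSet G) (n : ℕ) :
    MeasurableSet (hitSet X A G n) := by
  have : hitSet X A G n = ⋃ t, (fun h : History X A n => h.1 t) ⁻¹' G := by
    ext h
    simp [hitSet]
  rw [this]
  exact MeasurableSet.iUnion fun t => (by fun_prop : Measurable _) hG

lemma extend_mem_hitSet_iff {X A : Type*} {G : Set X} {n : ℕ} (p : (History X A n × A) × X) :
    History.extend n p ∈ hitSet X A G (n + 1) ↔ p.1.1 ∈ hitSet X A G n ∨ p.2 ∈ G := by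
  simp only [hitSet, History.extend, Set.mem_ofPred_eq]
  simp [Fin.exists_iff_castSucc, or_comm]

instance (P : Kernel (X × A) X) [IsMarkovKernel P] (n : ℕ) :
    IsMarkovKernel (nextState P n : Kernel (History X A n × A) X) := by
  unfold nextState
  infer_instance

instance (π : Policy X A) (n : ℕ) : IsMarkovKernel (π.act n) := π.isMarkovKernel_act n

instance (P : Kernel (X × A) X) [IsMarkovKernel P] (π : Policy X A) (x : X) (n : ℕ) :
    IsProbabilityMeasure (historyLaw P π x n) := by
  induction n with
  | zero => exact Measure.dirac.isProbabilityMeasure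
  | succ n ih =>
    exact Measure.isProbabilityMeasure_map (History.measurable_extend n).aemeasurable

variable (P : Kernel (X × A) X) (G : Set X)

lemma lintegral_historyLaw_succ [IsMarkovKernel P] (π : Policy X A) (x : X) (n : ℕ)
    {f : History X A (n + 1) → ENNReal} (hf : Measurable f) :
    ∫⁻ h, f h ∂(historyLaw P π x (n + 1)) =
      ∫⁻ h, ∫⁻ a, ∫⁻ x', f (History.extend n ((h, a), x')) ∂(P (h.1 (Fin.last n), a))
        ∂(π.act n h) ∂(historyLaw P π x n) := by
  have hfe : Measurable fun p : (History X A n × A) × X => f (History.extend n p) :=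
    hf.comp (History.measurable_extend n)
  rw [historyLaw, lintegral_map hf (History.measurable_extend n), Measure.lintegral_compProd hfe,
    Measure.lintegral_compProd hfe.lintegral_kernel_prod_right']
  rfl

/-! ### Verification: the continuation value as a (super)martingale -/

open Classical in
/-- The optimal conditional probability of visiting `G` when `b` steps remain after the history
`h`. -/
def continuationValue (b n : ℕ) (h : History X A n) : ENNReal :=
  if h ∈ hitSet X A G n then 1 else ENNReal.ofReal (bellmanValue P G b (h.1 (Fin.last n)))

variable {P G}

lemma measurable_continuationValue (hG : MeasurableSet G)
    (hV : ∀ b, Measurable (bellmanValue P G b)) (b n : ℕ) :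
    Measurable (continuationValue P G b n) := by
  classical
  exact Measurable.ite (measurableSet_hitSet hG n) measurable_const
    (((hV b).comp (by fun_prop : Measurable fun h : History X A n => h.1 (Fin.last n))).ennreal_ofReal)

variable [IsMarkovKernel P]

open Classical in
lemma lintegral_continuationValue_extend [Nonempty A] (hV : ∀ b, Measurable (bellmanValue P G b))
    (b n : ℕ) (h : History X A n) (a : A) :
    ∫⁻ x', continuationValue P G b (n + 1) (History.extend n ((h, a), x'))
      ∂(P (h.1 (Fin.last n), a)) = if h ∈ hitSet X A G n then 1 else
        ENNReal.ofReal (∫ x', bellmanValue P G b x' ∂(P (h.1 (Fin.last n), a))) := by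
  -- A visit made by the new state `x'` itself needs no separate case, because the Bellman value is
  -- already 1 on `G`.
  have hval : ∀ x', continuationValue P G b (n + 1) (History.extend n ((h, a), x')) =
      if h ∈ hitSet X A G n then 1 else ENNReal.ofReal (bellmanValue P G b x') := by
    intro x'
    by_cases hx' : x' ∈ G
    · simp [continuationValue, extend_mem_hitSet_iff, hx', bellmanValue_of_mem P G b hx']
    · have hlast : (History.extend n ((h, a), x')).1 (Fin.last (n + 1)) = x' := by
        simp [History.extend]
      simp [continuationValue, extend_mem_hitSet_iff, hx', hlast]
  simp_rw [hval]
  split_ifs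
  · simp
  · rw [ofReal_integral_eq_lintegral_ofReal]
    · exact Integrable.of_bound (hV b).aestronglyMeasurable 1 (.of_forall fun x' => by
        rw [Real.norm_of_nonneg (bellmanValue_mem_Icc P G b x').1]
        exact (bellmanValue_mem_Icc P G b x').2)
    · exact .of_forall fun x' => (bellmanValue_mem_Icc P G b x').1

lemma lintegral_continuationValue_zero [Nonempty A] (hG : MeasurableSet G)
    (hV : ∀ b, Measurable (bellmanValue P G b)) (π : Policy X A) (x : X) (b : ℕ) :
    ∫⁻ h, continuationValue P G b 0 h ∂(historyLaw P π x 0) =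
      ENNReal.ofReal (bellmanValue P G b x) := by
  rw [historyLaw, lintegral_dirac' _ (measurable_continuationValue hG hV b 0), continuationValue]
  split_ifs with h
  · obtain ⟨-, hx : x ∈ G⟩ := h
    simp [bellmanValue_of_mem P G b hx]
  · rfl

/-- Supermartingale property: no action beats the Bellman supremum. The horizon `n + b` stays fixed
while the induction trades elapsed for remaining steps. -/
lemma lintegral_continuationValue_le [Nonempty A] (hG : MeasurableSet G)
    (hV : ∀ b, Measurable (bellmanValue P G b)) (π : Policy X A) (x : X) (n b : ℕ) :
    ∫⁻ h, continuationValue P G b n h ∂(historyLaw P π x n) ≤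
      ENNReal.ofReal (bellmanValue P G (n + b) x) := by
  induction n generalizing b with
  | zero => simp [lintegral_continuationValue_zero hG hV]
  | succ n ih =>
    rw [lintegral_historyLaw_succ P π x n (measurable_continuationValue hG hV b (n + 1)),
      add_assoc, add_comm 1 b]
    refine (lintegral_mono fun h => ?_).trans (ih (b + 1))
    calc _ ≤ ∫⁻ _, continuationValue P G (b + 1) n h ∂(π.act n h) := by
          refine lintegral_mono fun a => ?_
          rw [lintegral_continuationValue_extend hV, continuationValue]
          split_ifs
          · exact le_rfl
          · exact ENNReal.ofReal_le_ofReal (integral_bellmanValue_le P G b _ a)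
      _ = _ := by simp

/-- Martingale property: before a visit the greedy action attains the Bellman value, and after one
the action is irrelevant. In `hmax`, `k + 1` steps remain at time `t`. -/
lemma lintegral_continuationValue_eq [Nonempty A] (hG : MeasurableSet G)
    (hV : ∀ b, Measurable (bellmanValue P G b)) {d : ℕ → X → A} (hd : ∀ t, Measurable (d t))
    (x : X) (n b : ℕ)
    (hmax : ∀ t k, t + (k + 1) = n + b → ∀ y a, ∫ x', bellmanValue P G k x' ∂(P (y, a)) ≤
      ∫ x', bellmanValue P G k x' ∂(P (y, d t y))) :
    ∫⁻ h, continuationValue P G b n h ∂(historyLaw P (Policy.deterministicMarkov d hd) x n) =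
      ENNReal.ofReal (bellmanValue P G (n + b) x) := by
  induction n generalizing b with
  | zero => simp [lintegral_continuationValue_zero hG hV]
  | succ n ih =>
    have hcomm : n + 1 + b = n + (b + 1) := by omega
    have hcv := measurable_continuationValue hG hV (P := P) b (n + 1)
    rw [lintegral_historyLaw_succ P _ x n hcv, hcomm, ← ih (b + 1) (by rwa [← hcomm])]
    refine lintegral_congr fun h => ?_
    -- Singletons of `A` are not assumed measurable, so integrating against a Dirac mass needs a
    -- measurable integrand.
    have hmeas : Measurable fun a => ∫⁻ x', continuationValue P G b (n + 1)
        (History.extend n ((h, a), x')) ∂(P (h.1 (Fin.last n), a)) := by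
      have h1 : Measurable fun p : (History X A n × A) × X =>
          continuationValue P G b (n + 1) (History.extend n p) :=
        hcv.comp (History.measurable_extend n)
      exact (h1.lintegral_kernel_prod_right' (κ := nextState P n)).comp measurable_prodMk_left
    rw [Policy.deterministicMarkov, Kernel.deterministic_apply, lintegral_dirac' _ hmeas,
      lintegral_continuationValue_extend hV, continuationValue]
    split_ifs with hh
    · rfl
    · rw [bellmanValue_succ_of_isMax P G b (fun hx => hh ⟨_, hx⟩) (hmax n b hcomm.symm _)]

/-- With no steps left, the continuation value is the indicator of having visited `G`. -/
lemma ofReal_successProb [Nonempty A] (hG : MeasurableSet G) (π : Policy X A) (x : X) (n : ℕ) :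
    ENNReal.ofReal (successProb P G π n x) =
      ∫⁻ h, continuationValue P G 0 n h ∂(historyLaw P π x n) := by
  have hval : continuationValue P G 0 n = (hitSet X A G n).indicator 1 := by
    ext h
    by_cases hh : h ∈ hitSet X A G n
    · simp [continuationValue, hh]
    · have : h.1 (Fin.last n) ∉ G := fun hx => hh ⟨_, hx⟩
      simp [continuationValue, hh, bellmanValue, this]
  rw [hval, lintegral_indicator_one (measurableSet_hitSet hG n), successProb, ofReal_measureReal]
  rfl

lemma successProb_le_bellmanValue [Nonempty A] (hG : MeasurableSet G)
    (hV : ∀ b, Measurable (bellmanValue P G b)) (π : Policy X A) (x : X) (n : ℕ) :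
    successProb P G π n x ≤ bellmanValue P G n x := by
  rw [← ENNReal.ofReal_le_ofReal_iff (bellmanValue_mem_Icc P G n x).1, ofReal_successProb hG]
  exact lintegral_continuationValue_le hG hV π x n 0

lemma successProb_deterministicMarkov [Nonempty A] (hG : MeasurableSet G)
    (hV : ∀ b, Measurable (bellmanValue P G b)) {a : ℕ → X → A} (ha : ∀ b, Measurable (a b))
    (hmax : ∀ b x a', ∫ x', bellmanValue P G b x' ∂(P (x, a')) ≤
      ∫ x', bellmanValue P G b x' ∂(P (x, a (b + 1) x))) (B : ℕ) (x : X) :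
    successProb P G (Policy.deterministicMarkov (fun t => a (B - t)) fun t => ha (B - t)) B x =
      bellmanValue P G B x := by
  have hnonneg : 0 ≤ successProb P G
      (Policy.deterministicMarkov (fun t => a (B - t)) fun t => ha (B - t)) B x :=
    measureReal_nonneg
  rw [← ENNReal.ofReal_eq_ofReal_iff hnonneg (bellmanValue_mem_Icc P G B x).1,
    ofReal_successProb hG]
  refine lintegral_continuationValue_eq hG hV _ x B 0 fun t k htk y a' => ?_
  -- Here `t < B`, so the truncated subtraction is exact.
  have : B - t = k + 1 := by omega
  rw [this]
  exact hmax k y a'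

/-- The bound valid for all policies is attained by the greedy policy for horizon `b`, so the
supremum is a maximum. -/
lemma optValue_eq_bellmanValue [Nonempty A] (hG : MeasurableSet G)
    (hV : ∀ b, Measurable (bellmanValue P G b)) {a : ℕ → X → A} (ha : ∀ b, Measurable (a b))
    (hmax : ∀ b x a', ∫ x', bellmanValue P G b x' ∂(P (x, a')) ≤
      ∫ x', bellmanValue P G b x' ∂(P (x, a (b + 1) x))) (b : ℕ) :
    optValue P G b = bellmanValue P G b := by
  ext x
  have hattained := successProb_deterministicMarkov hG hV ha hmax b x
  refine IsGreatest.csSup_eq ⟨⟨_, hattained⟩, ?_⟩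
  rintro _ ⟨π, rfl⟩
  exact successProb_le_bellmanValue hG hV π x b

end HistoryLaw

lemma exists_measurable_greedy {X A : Type*} [MetricSpace X] [MeasurableSpace X] [BorelSpace X]
    [MetricSpace A] [CompactSpace A] [Nonempty A] [MeasurableSpace A] [BorelSpace A]
    {P : Kernel (X × A) X} [IsMarkovKernel P] {G : Set X} (hP : IsWeaklyContinuous P)
    (hG : IsClosed G) :
    ∃ a : ℕ → X → A, (∀ b, Measurable (a b)) ∧
      ∀ b x a', ∫ x', bellmanValue P G b x' ∂(P (x, a')) ≤
        ∫ x', bellmanValue P G b x' ∂(P (x, a (b + 1) x)) := by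
  choose s hs hmax using fun b =>
    exists_measurable_argmax (upperSemicontinuous_integral_bellmanValue hP hG b)
  -- With `b` steps remaining the selector maximizes the integral of iterate `b - 1`; the value at
  -- `b = 0` is a dummy.
  exact ⟨fun b => s (b - 1), fun b => hs _, fun b x a' => hmax b x a'⟩

end Provability

end

theorem theorem4p2
    {𝒢 : Type*} [MetricSpace 𝒢] [CompactSpace 𝒢] [MeasurableSpace 𝒢] [BorelSpace 𝒢]
    {A : Type*} [MetricSpace A] [CompactSpace A] [Nonempty A] [MeasurableSpace A] [BorelSpace A]
    (W : ℝ) (_hW : 0 < W)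
    (P : Kernel (Provability.GoalMeasure 𝒢 W × A) (Provability.GoalMeasure 𝒢 W))
    [IsMarkovKernel P] (_hP : Provability.IsWeaklyContinuous P) (B : ℕ) :
    -- (a) the optimal values satisfy the Bellman recursion and are Borel measurable
    ((∀ x, Provability.optValue P {0} 0 x = Set.indicator {0} 1 x) ∧
      (∀ b < B, ∀ x, Provability.optValue P {0} (b + 1) x =
        max (Set.indicator {0} 1 x) (⨆ a, Provability.optActionValue P {0} (b + 1) x a)) ∧
      (∀ b ≤ B, Measurable (Provability.optValue P {0} b))) ∧
    -- (b) the supremum over actions is attained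
    (∀ b, 1 ≤ b → b ≤ B → ∀ x, ∃ a, ∀ a',
      Provability.optActionValue P {0} b x a' ≤ Provability.optActionValue P {0} b x a) ∧
    -- (c) measurable maximizers `a_b^*` exist, and the deterministic Markov policy that plays
    -- `a_b^*` when `b` steps remain (that is, at time `B - b`) is optimal from every state
    (∃ (aStar : ℕ → Provability.GoalMeasure 𝒢 W → A) (haStar : ∀ b, Measurable (aStar b)),
      (∀ b, 1 ≤ b → b ≤ B → ∀ x a', Provability.optActionValue P {0} b x a' ≤
        Provability.optActionValue P {0} b x (aStar b x)) ∧
      ∀ x, Provability.successProb P {0}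
          (Provability.Policy.deterministicMarkov (fun t => aStar (B - t)) fun t => haStar (B - t))
          B x = Provability.optValue P {0} B x) := by
  have hG : IsClosed ({0} : Set (Provability.GoalMeasure 𝒢 W)) := isClosed_singleton
  have hV := Provability.measurable_bellmanValue _hP hG
  obtain ⟨a, ha, hmax⟩ := Provability.exists_measurable_greedy _hP hG
  -- This turns each claim into one about `bellmanValue`, for which the recursion holds by
  -- definition.
  have hopt := Provability.optValue_eq_bellmanValue hG.measurableSet hV ha hmax
  have hmax' : ∀ b, 1 ≤ b → b ≤ B → ∀ x a', Provability.optActionValue P {0} b x a' ≤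
      Provability.optActionValue P {0} b x (a b x) := by
    intro b hb _ x a'
    obtain ⟨k, rfl⟩ := Nat.exists_eq_add_of_le' hb
    simp only [Provability.optActionValue, Nat.add_sub_cancel, hopt]
    exact hmax k x a'
  refine ⟨⟨fun x => ?_, fun b _ x => ?_, fun b _ => ?_⟩, fun b hb hbB x => ⟨a b x, ?_⟩,
    a, ha, hmax', fun x => ?_⟩
  · rw [hopt]
    rfl
  · simp only [Provability.optActionValue, Nat.add_sub_cancel, hopt]
    rfl
  · rw [hopt]
    exact hV b
  · exact hmax' b hb hbB x
  · rw [hopt]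
    exact Provability.successProb_deterministicMarkov hG.measurableSet hV ha hmax B x
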